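/- Let $\mathbb{K}$ be an algebraically closed field of characteristic zero, let $n\ge 1$, and let $\mathcal{A}\subset\mathbb{Z}_{\ge 0}^n$ be a non-empty finite set. For $t\ge 0$ let $t\mathcal{A}=\{a_1+\cdots+a_t \mid a_1,\dots,a_t\in\mathcal{A}\}$ be the $t$-fold sumset (with $0\mathcal{A}=\{0\}$). For $a\in\mathbb{Z}_{\ge 0}^n$ write $|a|=a_1+\cdots+a_n$, let $d=d_{\mathcal{A}}$ be the least integer $\delta\ge 0$ with $|a|\le\delta$ for all $a\in\mathcal{A}$, and put $$\Omega=\Omega_{n,d_{\mathcal{A}}}=\{m_a := x_0^{d-|a|}x_1^{a_1}\cdots x_n^{a_n}\mid a\in\mathcal{A}\}\subset\mathbb{K}[x_0,\dots,x_n].$$ Let $Y=Y_{n,d_{\mathcal{A}}}\subset\mathbb{P}^{|\mathcal{A}|-1}$ be the Zariski closure of the image of the rational map $\mathbb{P}^n\dashrightarrow\mathbb{P}^{|\mathcal{A}|-1}$, $p\mapsto (m_a(p))_{a\in\mathcal{A}}$ (the image of the points where not all $m_a$ vanish). Let $I(Y)\subset S=\mathbb{K}[w_a\mid a\in\mathcal{A}]$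 be the homogeneous ideal of $Y$, $A(Y)=S/I(Y)$ its homogeneous coordinate ring, and $\mathrm{HF}_{\mathcal{A}}(t)=\dim_{\mathbb{K}}A(Y)_t$ its Hilbert function. Let $\mathbb{K}[\Omega]$ be the subalgebra of $\mathbb{K}[x_0,\dots,x_n]$ generated by $\Omega$, and $\mathbb{K}[\Omega]_{e}$ the space of its forms of degree $e$. Then: (1) $\mathrm{HF}_{\mathcal{A}}(t)=\dim_{\mathbb{K}}\mathbb{K}[\Omega]_{td}=|t\mathcal{A}|$ for all integers $t\ge 0$. (2) There is a unique polynomial $\mathrm{HP}_{\mathcal{A}}\in\mathbb{Q}[t]$ (the Hilbert polynomial of $Y$) with $\mathrm{HP}_{\mathcal{A}}(t)=\mathrm{HF}_{\mathcal{A}}(t)$ for all sufficiently large $t$. It satisfies $|t\mathcal{A}|=\mathrm{HP}_{\mathcal{A}}(t)$ for all sufficiently large $t$, and its degree is $r=\dim Y\le n$, the dimension of $Y$ in the Zariski topology. -/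

import Mathlib

open scoped LinearAlgebra.Projectivization

namespace SumsetVeronese

noncomputable section

/-! ## Zariski topology, homogeneous ideal, coordinate ring, dimension -/

variable {K : Type*} [Field K] {ι : Type*}

/-- A polynomial vanishes at a point of the projective space with homogeneous coordinates indexed
by `ι`. It is only used for homogeneous polynomials, where the choice of the representative is
irrelevant (see `vanishesAt_mk_iff`). -/
def VanishesAt (f : MvPolynomial ι K) (q : ℙ K (ι → K)) : Prop :=
  MvPolynomial.eval q.rep f = 0

theorem vanishesAt_mk_iff {f : MvPolynomial ι K} {d : ℕ} (hf : f.IsHomogeneous d)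
    (v : ι → K) (hv : v ≠ 0) :
    VanishesAt f (Projectivization.mk K v hv) ↔ MvPolynomial.eval v f = 0 := by
  obtain ⟨c, hc⟩ := Projectivization.exists_smul_eq_mk_rep K v hv
  have h : MvPolynomial.eval ((c : K) • v) f = (c : K) ^ d * MvPolynomial.eval v f := by
    rw [MvPolynomial.eval_eq, MvPolynomial.eval_eq, Finset.mul_sum]
    refine Finset.sum_congr rfl fun e he => ?_
    have hd : e.sum (fun _ k => k) = d := by
      have := hf (MvPolynomial.mem_support_iff.mp he)
      rwa [Finsupp.weight_apply, show (e.sum fun i c => c • (1 : ι → ℕ) i) = e.sum fun _ k => k by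
        simp] at this
    simp only [Pi.smul_apply, smul_eq_mul, mul_pow, Finset.prod_mul_distrib,
      Finset.prod_pow_eq_pow_sum]
    rw [← hd, Finsupp.sum]
    ring
  have h2 : MvPolynomial.eval (Projectivization.mk K v hv).rep f
      = (c : K) ^ d * MvPolynomial.eval v f := by
    rw [← h, ← hc]; rfl
  rw [VanishesAt, h2]
  simp

/-- The common projective zero locus of a set of polynomials. -/
def projZeroLocus (s : Set (MvPolynomial ι K)) : Set (ℙ K (ι → K)) :=
  {q | ∀ f ∈ s, VanishesAt f q}

/-- Every element of the set is a homogeneous polynomial (of some degree). -/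
def AllHomogeneous (s : Set (MvPolynomial ι K)) : Prop :=
  ∀ f ∈ s, ∃ d : ℕ, f.IsHomogeneous d

variable (K ι) in
/-- The Zariski topology on projective space: the closed sets are the zero loci of sets of
homogeneous polynomials. -/
@[reducible] def zariskiTopology : TopologicalSpace (ℙ K (ι → K)) :=
  TopologicalSpace.ofClosed
    {Z | ∃ s : Set (MvPolynomial ι K), AllHomogeneous s ∧ Z = projZeroLocus s}
    (by
      refine ⟨{1}, ?_, ?_⟩
      · rintro f rfl
        exact ⟨0, MvPolynomial.isHomogeneous_one _ _⟩
      · ext q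
        simp [projZeroLocus, VanishesAt])
    (by
      intro T hT
      have hT' : ∀ Z ∈ T, ∃ s : Set (MvPolynomial ι K), AllHomogeneous s ∧ Z = projZeroLocus s :=
        fun Z hZ => hT hZ
      choose! s hs hZ using hT'
      refine ⟨⋃ Z ∈ T, s Z, ?_, ?_⟩
      · intro f hf
        simp only [Set.mem_iUnion] at hf
        obtain ⟨Z, hZT, hf⟩ := hf
        exact hs Z hZT f hf
      · ext q
        simp only [Set.mem_sInter, projZeroLocus, Set.mem_iUnion, Set.mem_ofPred_eq]
        constructor
        · rintro h f ⟨Z, hZT, hf⟩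
          have := h Z hZT
          rw [hZ Z hZT] at this
          exact this f hf
        · intro h Z hZT
          rw [hZ Z hZT]
          exact fun f hf => h f ⟨Z, hZT, hf⟩)
    (by
      rintro _ ⟨s, hs, rfl⟩ _ ⟨t, ht, rfl⟩
      refine ⟨{h | ∃ f ∈ s, ∃ g ∈ t, h = f * g}, ?_, ?_⟩
      · rintro _ ⟨f, hf, g, hg, rfl⟩
        obtain ⟨d, hd⟩ := hs f hf
        obtain ⟨e, he⟩ := ht g hg
        exact ⟨d + e, hd.mul he⟩
      · ext q
        constructor
        · rintro (h | h) _ ⟨f, hf, g, hg, rfl⟩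
          · have := h f hf
            simp_all [VanishesAt]
          · have := h g hg
            simp_all [VanishesAt]
        · intro h
          by_contra hq
          simp only [Set.mem_union, not_or] at hq
          obtain ⟨h1, h2⟩ := hq
          simp only [projZeroLocus, Set.mem_ofPred_eq, not_forall] at h1 h2
          obtain ⟨f, hf, hfq⟩ := h1
          obtain ⟨g, hg, hgq⟩ := h2
          have := h _ ⟨f, hf, g, hg, rfl⟩
          simp only [VanishesAt, map_mul, mul_eq_zero] at this hfq hgq
          tauto)

/-- The dimension of a subset of projective space: its Krull dimension as a topological space, for
the topology induced by the Zariski topology. -/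
def projDim (Y : Set (ℙ K (ι → K))) : WithBot ℕ∞ :=
  @topologicalKrullDim Y (TopologicalSpace.induced Subtype.val (zariskiTopology K ι))

/-- The homogeneous ideal `I(Y)` of a subset `Y` of projective space: the ideal generated by all
homogeneous polynomials that vanish at every point of `Y`. -/
def homogeneousIdeal (Y : Set (ℙ K (ι → K))) : Ideal (MvPolynomial ι K) :=
  Ideal.span {f | (∃ d : ℕ, f.IsHomogeneous d) ∧ ∀ q ∈ Y, VanishesAt f q}

/-- The homogeneous coordinate ring `A(Y) = S / I(Y)`. -/
abbrev CoordinateRing (Y : Set (ℙ K (ι → K))) : Type _ :=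
  MvPolynomial ι K ⧸ homogeneousIdeal Y

/-- The graded piece `A(Y)_t`: the classes of the forms of degree `t`. -/
def coordinateRingPiece (Y : Set (ℙ K (ι → K))) (t : ℕ) : Submodule K (CoordinateRing Y) :=
  (MvPolynomial.homogeneousSubmodule ι K t).map
    (Ideal.Quotient.mkₐ K (homogeneousIdeal Y)).toLinearMap

/-- The Hilbert function `t ↦ dim_K A(Y)_t`. -/
def hilbertFunction (Y : Set (ℙ K (ι → K))) (t : ℕ) : ℕ :=
  Module.finrank K (coordinateRingPiece Y t)

end

/-- The rational polynomial `P` agrees with the numerical function `H` at all large integers. -/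
def AgreesEventually (H : ℕ → ℕ) (P : Polynomial ℚ) : Prop :=
  ∀ᶠ t : ℕ in Filter.atTop, (H t : ℚ) = P.eval (t : ℚ)

/-! ## Sumsets -/

/-- The `t`-fold sumset `tA = {a₁ + ⋯ + a_t | a_i ∈ A}`; the empty sum gives `0A = {0}`. -/
def sumset {n : ℕ} (t : ℕ) (A : Finset (Fin n → ℕ)) : Finset (Fin n → ℕ) :=
  (Fintype.piFinset fun _ : Fin t => A).image fun a => ∑ i, a i

/-- `d_A`, the least `δ` with `a₁ + ⋯ + a_n ≤ δ` for all `a ∈ A`. -/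
def dA {n : ℕ} (A : Finset (Fin n → ℕ)) : ℕ :=
  A.sup fun a => ∑ i, a i

/-! ## The monomial projection of the Veronese variety attached to `A` -/

noncomputable section

variable (K : Type*) [Field K] {n : ℕ} (A : Finset (Fin n → ℕ))

/-- The monomial `x₀ ^ (d_A - |a|) x₁ ^ a₁ ⋯ x_n ^ a_n` of degree `d_A`, for `a ∈ A` (the
subtraction does not truncate for `a ∈ A`). -/
def omegaMonomial (a : A) : MvPolynomial (Fin (n + 1)) K :=
  MvPolynomial.X 0 ^ (dA A - ∑ i, a.1 i) * ∏ i : Fin n, MvPolynomial.X i.succ ^ a.1 i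

/-- The values at `x` of all the monomials attached to `A`. -/
def omegaValues (x : Fin (n + 1) → K) : A → K :=
  fun a => MvPolynomial.eval x (omegaMonomial K A a)

/-- The set of the points `(m₁(p) : ⋯ : m_{|A|}(p))`, for those points `p = (x₀ : ⋯ : x_n)` of
`ℙⁿ` at which not all the monomials vanish: the image of the rational map
`ℙⁿ ⇢ ℙ^(|A|-1)`. The coordinates of `ℙ^(|A|-1)` are indexed by the elements of `A`. -/
def rationalMapImage : Set (ℙ K (A → K)) :=
  {q | ∃ x : Fin (n + 1) → K, x ≠ 0 ∧
    ∃ h : omegaValues K A x ≠ 0, q = Projectivization.mk K (omegaValues K A x) h}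

/-- The monomial projection `Y_{n,d_A}`: the Zariski closure of the image of the rational map. -/
def monomialProjection : Set (ℙ K (A → K)) :=
  @closure _ (zariskiTopology K A) (rationalMapImage K A)

/-- The monomial ring `K[Ω_{n,d_A}] ⊆ K[x₀, …, x_n]`. -/
def omegaAlgebra : Subalgebra K (MvPolynomial (Fin (n + 1)) K) :=
  Algebra.adjoin K (Set.range (omegaMonomial K A))

/-- The forms of degree `e` that belong to `K[Ω_{n,d_A}]`. -/
def omegaAlgebraPiece (e : ℕ) : Submodule K (MvPolynomial (Fin (n + 1)) K) :=
  Subalgebra.toSubmodule (omegaAlgebra K A) ⊓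
    MvPolynomial.homogeneousSubmodule (Fin (n + 1)) K e

end

end SumsetVeronese

namespace SumsetVeronese

/-! ### Counting exponent vectors of given degree -/

section Counting

variable {ι : Type*} [Fintype ι]

/-! Substituting `m_a` for `w_a` sends a form of degree `t` to zero exactly when it vanishes on `Y`,
because `K` is infinite. The image of the forms of degree `t` is `K[Ω]_{td}`. It is spanned by
monomials whose exponents, once the redundant exponent of `x₀` is dropped, are the elements of `tA`.
This gives part (1) (`hilbertFunction_monomialProjection`, `finrank_omegaAlgebraPiece`).

That `|tA|` is eventually polynomial is combinatorial (`exists_agreesEventually_ncard_image`). Each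
element of `tA` has a lexicographically least representation as a sum of `t` elements of `A`. The
representations that are not least form an upper set, finitely generated by Dickson's lemma, and
inclusion-exclusion over the generators counts the rest.

The degree of `P` is pinched against chains of irreducible closed sets. A chain of length `k` in `Y`
makes the Hilbert function grow at least like `t.choose k` along multiples of a constant, so `k ≤
deg P` (`exists_choose_le_hilbertFunction`). Conversely, take a set `J` of coordinates which, with
the constant 1, spans all coordinate functions on `A`. Then `tA` injects into a box of dimension
`|J|`, so `deg P ≤ |J|` (`card_sumset_le`). Closures of subtori give a chain of length `|J|` for
some such `J` (`exists_ltSeries_of_rowSpan`), so all three numbers agree. -/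

theorem setOf_degree_eq_coe_finsuppAntidiag [DecidableEq ι] (t : ℕ) :
    {u : ι →₀ ℕ | u.degree = t} = (Finset.univ.finsuppAntidiag t : Finset (ι →₀ ℕ)) := by
  ext u
  simp [Finset.mem_finsuppAntidiag, Finsupp.degree_eq_sum]

theorem finite_setOf_degree_eq (t : ℕ) : {u : ι →₀ ℕ | u.degree = t}.Finite := by
  classical
  rw [setOf_degree_eq_coe_finsuppAntidiag]
  exact Finset.finite_toSet _

theorem ncard_setOf_degree_eq (t : ℕ) :
    {u : ι →₀ ℕ | u.degree = t}.ncard = (Fintype.card ι + t - 1).choose t := by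
  classical
  rw [setOf_degree_eq_coe_finsuppAntidiag, Set.ncard_coe_finset,
    Finset.card_finsuppAntidiag_nat_eq_choose, Finset.card_univ]

theorem exists_agreesEventually_ncard_le [Nonempty ι] (v : ι →₀ ℕ) :
    ∃ P, AgreesEventually (fun t => {u : ι →₀ ℕ | u.degree = t ∧ v ≤ u}.ncard) P := by
  refine ⟨Polynomial.preHilbertPoly ℚ (Fintype.card ι - 1) v.degree, ?_⟩
  filter_upwards [Filter.eventually_ge_atTop v.degree] with t ht
  have h : {u : ι →₀ ℕ | u.degree = t ∧ v ≤ u}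
      = (fun u => v + u) '' {u : ι →₀ ℕ | u.degree = t - v.degree} := by
    ext u
    simp only [Set.mem_ofPred_eq, Set.mem_image]
    constructor
    · rintro ⟨hu, hv⟩
      refine ⟨u - v, ?_, add_tsub_cancel_of_le hv⟩
      have := congrArg Finsupp.degree (add_tsub_cancel_of_le hv)
      rw [map_add] at this
      omega
    · rintro ⟨w, hw, rfl⟩
      exact ⟨by rw [map_add, hw]; omega, le_self_add⟩
  have hpos : 0 < Fintype.card ι := Fintype.card_pos
  rw [h, Set.ncard_image_of_injective _ (add_right_injective v), ncard_setOf_degree_eq,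
    Polynomial.preHilbertPoly_eq_choose_sub_add ℚ _ ht,
    show Fintype.card ι + (t - v.degree) - 1 = t - v.degree + (Fintype.card ι - 1) by omega,
    Nat.choose_symm_add]

/-- Inclusion-exclusion, one generator at a time: the vectors above both `v` and `g` are those above
`v ⊔ g`, which is why `v` must vary in the induction. -/
theorem exists_agreesEventually_ncard_avoiding [Nonempty ι] (G : Finset (ι →₀ ℕ)) (v : ι →₀ ℕ) :
    ∃ P, AgreesEventually
      (fun t => {u : ι →₀ ℕ | u.degree = t ∧ v ≤ u ∧ ∀ g ∈ G, ¬ g ≤ u}.ncard) P := by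
  classical
  induction G using Finset.induction_on generalizing v with
  | empty => simpa using exists_agreesEventually_ncard_le v
  | insert g G _ ih =>
    obtain ⟨P, hP⟩ := ih v
    obtain ⟨Q, hQ⟩ := ih (v ⊔ g)
    refine ⟨P - Q, ?_⟩
    filter_upwards [hP, hQ] with t hPt hQt
    rw [Polynomial.eval_sub, ← hPt, ← hQt, eq_sub_iff_add_eq, ← Nat.cast_add]
    congr 1
    have hfin {p : (ι →₀ ℕ) → Prop} : {u : ι →₀ ℕ | u.degree = t ∧ p u}.Finite :=
      (finite_setOf_degree_eq t).subset fun u hu => hu.1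
    rw [← Set.ncard_union_eq ?_ hfin hfin]
    · congr 1
      ext u
      simp only [Set.mem_union, Set.mem_ofPred_eq, Finset.forall_mem_insert, sup_le_iff]
      tauto
    · rw [Set.disjoint_left]
      rintro u ⟨_, _, h⟩ ⟨_, h', _⟩
      exact h g (Finset.mem_insert_self _ _) (sup_le_iff.1 h').2

/-- Dickson's lemma: the minimal elements form an antichain in a well-quasi-order, hence a finite
set. -/
theorem exists_finset_forall_mem_iff_of_isUpperSet {U : Set (ι →₀ ℕ)} (hU : IsUpperSet U) :
    ∃ G : Finset (ι →₀ ℕ), ∀ u, u ∈ U ↔ ∃ g ∈ G, g ≤ u := by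
  have hfin : {u | Minimal (· ∈ U) u}.Finite :=
    WellQuasiOrderedLE.finite_of_isAntichain (setOfPred_minimal_antichain _)
  refine ⟨hfin.toFinset, fun u => ⟨fun hu => ?_, ?_⟩⟩
  · obtain ⟨g, hgu, hg⟩ := exists_minimal_le_of_wellFoundedLT (· ∈ U) u hu
    exact ⟨g, by simpa using hg, hgu⟩
  · rintro ⟨g, hg, hgu⟩
    have hg' : Minimal (· ∈ U) g := by simpa using hg
    exact hU hgu hg'.prop

/-- Khovanskii's theorem: the number of values of an additive map on the exponent vectors of
degree `t` is eventually a polynomial in `t`. -/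
theorem exists_agreesEventually_ncard_image [Nonempty ι] {M : Type*} [AddCommMonoid M]
    (L : (ι →₀ ℕ) →+ M) :
    ∃ P, AgreesEventually (fun t => (L '' {u : ι →₀ ℕ | u.degree = t}).ncard) P := by
  classical
  let _ : LinearOrder ι := LinearOrder.lift' _ (Fintype.equivFin ι).injective
  -- `U` holds the vectors that are not lexicographically least among those of the same degree and
  -- the same value of `L`. It is an upper set since degree and `L` are additive and the order is
  -- translation invariant.
  let U : Set (ι →₀ ℕ) := {u | ∃ w, w.degree = u.degree ∧ L w = L u ∧ toLex w < toLex u}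
  have hU : IsUpperSet U := by
    rintro u v huv ⟨w, hdeg, hL, hlt⟩
    obtain ⟨c, rfl⟩ := exists_add_of_le huv
    exact ⟨w + c, by simp [hdeg], by simp [hL], add_lt_add_left hlt (toLex c)⟩
  obtain ⟨G, hG⟩ := exists_finset_forall_mem_iff_of_isUpperSet hU
  obtain ⟨P, hP⟩ := exists_agreesEventually_ncard_avoiding G 0
  refine ⟨P, ?_⟩
  convert hP using 2 with t
  have himage : L '' {u : ι →₀ ℕ | u.degree = t} = L '' {u | u.degree = t ∧ u ∉ U} := by
    refine (Set.image_mono fun u hu => hu.1).antisymm' ?_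
    rintro _ ⟨u, hu, rfl⟩
    have hfin : {w : ι →₀ ℕ | w.degree = t ∧ L w = L u}.Finite :=
      (finite_setOf_degree_eq t).subset fun w hw => hw.1
    obtain ⟨w, ⟨hw, hLw⟩, hmin⟩ := Set.exists_min_image _ toLex hfin ⟨u, hu, rfl⟩
    refine ⟨w, ⟨hw, ?_⟩, hLw⟩
    rintro ⟨w', hdeg, hL, hlt⟩
    exact (hmin w' ⟨hdeg.trans hw, hL.trans hLw⟩).not_gt hlt
  rw [himage, Set.InjOn.ncard_image]
  · congr 1
    ext u
    simp [hG]
  · rintro u ⟨hu, huU⟩ v ⟨hv, hvU⟩ huv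
    by_contra hne
    rcases lt_or_gt_of_ne (fun h => hne (toLex.injective h) : toLex u ≠ toLex v) with h | h
    · exact hvU ⟨u, hu.trans hv.symm, huv, h⟩
    · exact huU ⟨v, hv.trans hu.symm, huv.symm, h⟩

end Counting

/-! ### Growth of polynomials -/

/-- Otherwise `G - F` has positive degree and negative leading coefficient, so it tends to `-∞`. -/
theorem natDegree_le_of_eventually_eval_le {F G : Polynomial ℚ} (hF : 0 < F.leadingCoeff)
    (h : ∀ᶠ t : ℕ in Filter.atTop, F.eval (t : ℚ) ≤ G.eval (t : ℚ)) :
    F.natDegree ≤ G.natDegree := by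
  by_contra! hlt
  have hdeg : (G - F).natDegree = F.natDegree := Polynomial.natDegree_sub_eq_right_of_natDegree_lt hlt
  have hlead : (G - F).leadingCoeff = -F.leadingCoeff := by
    rw [Polynomial.leadingCoeff, hdeg, Polynomial.coeff_sub,
      Polynomial.coeff_eq_zero_of_natDegree_lt hlt, zero_sub]
    rfl
  have hbot := (Polynomial.tendsto_atBot_of_leadingCoeff_nonpos (G - F)
    (Polynomial.natDegree_pos_iff_degree_pos.1 (by omega)) (by rw [hlead]; linarith)).comp
    (tendsto_natCast_atTop_atTop (R := ℚ))
  obtain ⟨t, ht, ht'⟩ := (h.and (hbot.eventually_lt_atBot 0)).exists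
  simp only [Function.comp_apply, Polynomial.eval_sub] at ht'
  linarith

theorem AgreesEventually.unique {H : ℕ → ℕ} {P Q : Polynomial ℚ} (hP : AgreesEventually H P)
    (hQ : AgreesEventually H Q) : P = Q := by
  refine Polynomial.eq_of_infinite_eval_eq P Q ?_
  obtain ⟨N, hN⟩ := Filter.eventually_atTop.1 (hP.and hQ)
  refine ((Set.Ici_infinite N).image (Nat.cast_injective (R := ℚ)).injOn).mono ?_
  rintro _ ⟨t, ht, rfl⟩
  exact (hN t ht).1.symm.trans (hN t ht).2

theorem AgreesEventually.natDegree_le {H : ℕ → ℕ} {P : Polynomial ℚ} (hP : AgreesEventually H P)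
    {D r : ℕ} (h : ∀ t, H t ≤ (t * D + 1) ^ r) : P.natDegree ≤ r := by
  by_cases hlead : 0 < P.leadingCoeff
  · refine (natDegree_le_of_eventually_eval_le (G := (Polynomial.X * Polynomial.C (D : ℚ) + 1) ^ r)
      hlead ?_).trans ?_
    · filter_upwards [hP] with t ht
      rw [← ht]
      have := h t
      simp only [Polynomial.eval_pow, Polynomial.eval_add, Polynomial.eval_mul, Polynomial.eval_X,
        Polynomial.eval_C, Polynomial.eval_one]
      exact_mod_cast this
    · compute_degree
  -- A polynomial of positive degree with nonpositive leading coefficient becomes negative, unlike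
  -- `H`.
  · by_contra! hr
    have hbot := (Polynomial.tendsto_atBot_of_leadingCoeff_nonpos P
      (Polynomial.natDegree_pos_iff_degree_pos.1 (by omega)) (not_lt.1 hlead)).comp
      (tendsto_natCast_atTop_atTop (R := ℚ))
    obtain ⟨t, ht, ht'⟩ := (Filter.Eventually.and hP (hbot.eventually_lt_atBot 0)).exists
    simp only [Function.comp_apply, ← ht] at ht'
    exact absurd ht' (Nat.cast_nonneg _).not_gt

theorem AgreesEventually.le_natDegree {H : ℕ → ℕ} {P : Polynomial ℚ} (hP : AgreesEventually H P)
    {E k : ℕ} (hE : 0 < E) (h : ∀ s, s.choose k ≤ H (s * E)) : k ≤ P.natDegree := by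
  have hle := natDegree_le_of_eventually_eval_le
    -- At `s ≥ k` this polynomial of degree `k` takes the value `s.choose k`.
    (F := Polynomial.preHilbertPoly ℚ k k)
    (G := P.comp (Polynomial.X * Polynomial.C (E : ℚ)))
    (by rw [Polynomial.leadingCoeff_preHilbertPoly]; positivity) ?_
  · rw [Polynomial.natDegree_preHilbertPoly, Polynomial.natDegree_comp] at hle
    rwa [Polynomial.natDegree_mul_C (by positivity), Polynomial.natDegree_X, mul_one] at hle
  · have hE' : Filter.Tendsto (fun s : ℕ => s * E) Filter.atTop Filter.atTop :=
      Filter.tendsto_id.atTop_mul_const' hE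
    filter_upwards [hE'.eventually hP, Filter.eventually_ge_atTop k] with s hs hk
    rw [Polynomial.preHilbertPoly_eq_choose_sub_add ℚ _ hk, Nat.sub_add_cancel hk]
    have := h s
    simp only [Polynomial.eval_comp, Polynomial.eval_mul, Polynomial.eval_X, Polynomial.eval_C]
    rw [← Nat.cast_mul, ← hs]
    exact_mod_cast this

/-! ### Rank-nullity on submodules -/

section LinearAlgebra

variable {K V V₁ V₂ : Type*} [Field K] [AddCommGroup V] [Module K V] [AddCommGroup V₁] [Module K V₁]
  [AddCommGroup V₂] [Module K V₂]

theorem finrank_map_eq_of_forall_eq_zero_iff (p : Submodule K V) (f : V →ₗ[K] V₁) (g : V →ₗ[K] V₂)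
    (h : ∀ x ∈ p, f x = 0 ↔ g x = 0) :
    Module.finrank K (p.map f) = Module.finrank K (p.map g) := by
  have hker : LinearMap.ker (f.domRestrict p) = LinearMap.ker (g.domRestrict p) := by
    ext x
    simpa using h x x.2
  rw [← LinearMap.range_domRestrict, ← LinearMap.range_domRestrict,
    ← (f.domRestrict p).quotKerEquivRange.finrank_eq,
    ← (g.domRestrict p).quotKerEquivRange.finrank_eq, hker]

theorem finrank_add_finrank_map_le (p q : Submodule K V) [FiniteDimensional K p]
    (f : V →ₗ[K] V₁) (hqp : q ≤ p) (hq : q ≤ LinearMap.ker f) :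
    Module.finrank K q + Module.finrank K (p.map f) ≤ Module.finrank K p := by
  rw [← (f.domRestrict p).finrank_range_add_finrank_ker, LinearMap.range_domRestrict, add_comm]
  gcongr
  rw [← (Submodule.comapSubtypeEquivOfLe hqp).finrank_eq]
  exact Submodule.finrank_mono fun x hx => hq hx

end LinearAlgebra

/-! ### Forms restricted to subsets of projective space -/

section Forms

variable {K : Type*} [Field K] {ι : Type*}

attribute [local instance] zariskiTopology

theorem isClosed_iff_exists_projZeroLocus {Z : Set (ℙ K (ι → K))} :
    IsClosed Z ↔ ∃ s : Set (MvPolynomial ι K), AllHomogeneous s ∧ Z = projZeroLocus s := by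
  rw [← isOpen_compl_iff]
  change Zᶜᶜ ∈ {Z : Set (ℙ K (ι → K)) | _} ↔ _
  rw [compl_compl]
  rfl

theorem isClosed_setOf_vanishesAt {f : MvPolynomial ι K} {d : ℕ} (hf : f.IsHomogeneous d) :
    IsClosed {q : ℙ K (ι → K) | VanishesAt f q} :=
  isClosed_iff_exists_projZeroLocus.2 ⟨{f}, by rintro _ rfl; exact ⟨d, hf⟩,
    by simp [projZeroLocus]⟩

theorem exists_form_not_vanishesAt {Z : Set (ℙ K (ι → K))} (hZ : IsClosed Z) {q : ℙ K (ι → K)}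
    (hq : q ∉ Z) :
    ∃ (f : MvPolynomial ι K) (d : ℕ), f.IsHomogeneous d ∧ (∀ z ∈ Z, VanishesAt f z) ∧
      ¬ VanishesAt f q := by
  obtain ⟨s, hs, rfl⟩ := isClosed_iff_exists_projZeroLocus.1 hZ
  simp only [projZeroLocus, Set.mem_ofPred_eq, not_forall] at hq
  obtain ⟨f, hf, hfq⟩ := hq
  obtain ⟨d, hd⟩ := hs f hf
  exact ⟨f, d, hd, fun z hz => hz f hf, hfq⟩

theorem vanishesAt_mul {f g : MvPolynomial ι K} {q : ℙ K (ι → K)} :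
    VanishesAt (f * g) q ↔ VanishesAt f q ∨ VanishesAt g q := by
  simp [VanishesAt]

theorem IsPreirreducible.vanishesAt_or {W : Set (ℙ K (ι → K))} (hW : IsPreirreducible W)
    {f g : MvPolynomial ι K} {d e : ℕ} (hf : f.IsHomogeneous d) (hg : g.IsHomogeneous e)
    (h : ∀ q ∈ W, VanishesAt (f * g) q) :
    (∀ q ∈ W, VanishesAt f q) ∨ ∀ q ∈ W, VanishesAt g q :=
  isPreirreducible_iff_isClosed_union_isClosed.1 hW _ _ (isClosed_setOf_vanishesAt hf)
    (isClosed_setOf_vanishesAt hg) fun q hq => vanishesAt_mul.1 (h q hq)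

theorem exists_X_not_vanishesAt (q : ℙ K (ι → K)) :
    ∃ i, ¬ VanishesAt (MvPolynomial.X i : MvPolynomial ι K) q := by
  have := q.rep_nonzero
  contrapose! this
  funext i
  simpa [VanishesAt] using this i

/-- Polynomials as functions on a set of points of projective space, by means of the chosen
representatives of the points. -/
noncomputable def evalOn (Z : Set (ℙ K (ι → K))) : MvPolynomial ι K →ₐ[K] (Z → K) :=
  AlgHom.pi fun q => MvPolynomial.aeval q.1.rep

theorem evalOn_apply (Z : Set (ℙ K (ι → K))) (f : MvPolynomial ι K) (q : Z) :
    evalOn Z f q = MvPolynomial.eval q.1.rep f := by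
  simp [evalOn, MvPolynomial.aeval_eq_eval]

theorem evalOn_eq_zero_iff {Z : Set (ℙ K (ι → K))} {f : MvPolynomial ι K} :
    evalOn Z f = 0 ↔ ∀ q ∈ Z, VanishesAt f q := by
  simp [funext_iff, evalOn_apply, VanishesAt]

/-- Evaluation at fixed representatives is a ring homomorphism that kills the generators, hence the
whole ideal. -/
theorem mem_homogeneousIdeal_iff {Z : Set (ℙ K (ι → K))} {f : MvPolynomial ι K} {d : ℕ}
    (hf : f.IsHomogeneous d) : f ∈ homogeneousIdeal Z ↔ ∀ q ∈ Z, VanishesAt f q := by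
  refine ⟨fun h => ?_, fun h => Ideal.subset_span ⟨⟨d, hf⟩, h⟩⟩
  rw [← evalOn_eq_zero_iff]
  have hle : homogeneousIdeal Z ≤ RingHom.ker (evalOn Z) :=
    Ideal.span_le.2 fun g hg => evalOn_eq_zero_iff.2 hg.2
  exact hle h

/-- Allows `A(Z)_t` to be replaced by its image under any linear map with the right kernel on forms:
restriction to points, multiplication by a form, or pullback. -/
theorem hilbertFunction_eq_finrank_map {V : Type*} [AddCommGroup V] [Module K V]
    (Z : Set (ℙ K (ι → K))) (t : ℕ) (L : MvPolynomial ι K →ₗ[K] V)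
    (h : ∀ f : MvPolynomial ι K, f.IsHomogeneous t → (L f = 0 ↔ ∀ q ∈ Z, VanishesAt f q)) :
    hilbertFunction Z t
      = Module.finrank K ((MvPolynomial.homogeneousSubmodule ι K t).map L) := by
  refine finrank_map_eq_of_forall_eq_zero_iff _ _ _ fun f hf => ?_
  rw [h f hf, ← mem_homogeneousIdeal_iff hf]
  simp [Ideal.Quotient.eq_zero_iff_mem]

theorem hilbertFunction_eq_finrank_evalOn (Z : Set (ℙ K (ι → K))) (t : ℕ) :
    hilbertFunction Z t = Module.finrank K
      ((MvPolynomial.homogeneousSubmodule ι K t).map (evalOn Z).toLinearMap) :=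
  hilbertFunction_eq_finrank_map Z t _ fun _ _ => evalOn_eq_zero_iff

theorem map_funLeft_evalOn {Z W : Set (ℙ K (ι → K))} (hZW : Z ⊆ W)
    (p : Submodule K (MvPolynomial ι K)) :
    (p.map (evalOn W).toLinearMap).map (LinearMap.funLeft K K (Set.inclusion hZW))
      = p.map (evalOn Z).toLinearMap := by
  rw [← Submodule.map_comp]
  congr 1

variable [Finite ι]

instance finiteDimensional_homogeneousSubmodule (t : ℕ) :
    FiniteDimensional K (MvPolynomial.homogeneousSubmodule ι K t) :=
  Module.Finite.iff_fg.2 (MvPolynomial.homogeneousSubmodule_fg ι K t)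

theorem hilbertFunction_mono {Z W : Set (ℙ K (ι → K))} (hZW : Z ⊆ W) (t : ℕ) :
    hilbertFunction Z t ≤ hilbertFunction W t := by
  rw [hilbertFunction_eq_finrank_evalOn, hilbertFunction_eq_finrank_evalOn,
    ← map_funLeft_evalOn hZW]
  exact Submodule.finrank_map_le _ _

/-- Multiplication by a form that vanishes on `Z` and is a nonzerodivisor on `W`. -/
theorem hilbertFunction_add_le {Z W : Set (ℙ K (ι → K))} (hZW : Z ⊆ W) {f : MvPolynomial ι K}
    {e : ℕ} (hf : f.IsHomogeneous e) (hfZ : ∀ q ∈ Z, VanishesAt f q) (t : ℕ)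
    (hfW : ∀ g : MvPolynomial ι K, g.IsHomogeneous t →
      (∀ q ∈ W, VanishesAt (f * g) q) → ∀ q ∈ W, VanishesAt g q) :
    hilbertFunction W t + hilbertFunction Z (t + e) ≤ hilbertFunction W (t + e) := by
  have h1 : hilbertFunction W t = Module.finrank K ((MvPolynomial.homogeneousSubmodule ι K t).map
      ((evalOn W).toLinearMap ∘ₗ LinearMap.mulLeft K f)) := by
    refine hilbertFunction_eq_finrank_map W t _ fun g hg => ?_
    change evalOn W (f * g) = 0 ↔ _
    rw [evalOn_eq_zero_iff]
    exact ⟨hfW g hg, fun h q hq => vanishesAt_mul.2 (Or.inr (h q hq))⟩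
  rw [h1, hilbertFunction_eq_finrank_evalOn, hilbertFunction_eq_finrank_evalOn W,
    ← map_funLeft_evalOn hZW]
  -- The multiples of `f` form a copy of `A(W)_t` in `A(W)_{t+e}`, and they lie in the kernel of the
  -- restriction onto `A(Z)_{t+e}`.
  refine finrank_add_finrank_map_le _ _ _ ?_ ?_
  · rintro _ ⟨g, hg, rfl⟩
    exact ⟨f * g, by simpa [add_comm] using hf.mul hg, rfl⟩
  · rintro _ ⟨g, hg, rfl⟩
    ext q
    have := hfZ q q.2
    simp only [VanishesAt] at this
    simp [LinearMap.funLeft_apply, evalOn_apply, this]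

theorem hilbertFunction_monotone {W : Set (ℙ K (ι → K))} (hW : IsIrreducible W) :
    Monotone (hilbertFunction W) := by
  refine monotone_nat_of_le_succ fun t => ?_
  obtain ⟨q, hq⟩ := hW.nonempty
  obtain ⟨i, hi⟩ := exists_X_not_vanishesAt q
  -- By irreducibility, a coordinate that is nonzero at one point of `W` is a nonzerodivisor on `W`.
  refine (Nat.le_add_right _ _).trans (hilbertFunction_add_le (Set.empty_subset W)
    (MvPolynomial.isHomogeneous_X K i) (by simp) t fun g hg h => ?_)
  exact (IsPreirreducible.vanishesAt_or hW.2 (MvPolynomial.isHomogeneous_X K i) hg h).resolve_left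
    fun h' => hi (h' q hq)

theorem hilbertFunction_zero_pos {W : Set (ℙ K (ι → K))} (hW : W.Nonempty) :
    0 < hilbertFunction W 0 := by
  rw [hilbertFunction_eq_finrank_evalOn, Module.finrank_pos_iff, Submodule.nontrivial_iff_ne_bot]
  intro h
  have h1 : evalOn W 1 = 0 := by
    rw [← Submodule.mem_bot K, ← h]
    exact ⟨1, MvPolynomial.isHomogeneous_one _ _, rfl⟩
  obtain ⟨q, hq⟩ := hW
  simpa [VanishesAt] using evalOn_eq_zero_iff.1 h1 q hq

/-- The growth of the Hilbert function along a chain of irreducible closed subsets. -/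
theorem exists_choose_le_hilbertFunction {Y : Set (ℙ K (ι → K))}
    (s : LTSeries (TopologicalSpace.IrreducibleCloseds Y)) :
    ∃ E, 0 < E ∧ ∀ t : ℕ, t.choose s.length ≤
      hilbertFunction (Subtype.val '' (s.last : Set Y)) (t * E) := by
  have hirr (Z : TopologicalSpace.IrreducibleCloseds Y) :
      IsIrreducible (Subtype.val '' (Z : Set Y)) :=
    Z.isIrreducible.image _ continuous_subtype_val.continuousOn
  induction s using RelSeries.inductionOn' with
  | singleton Z =>
    refine ⟨1, one_pos, fun t => ?_⟩
    have := hilbertFunction_zero_pos (hirr Z).nonempty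
    have := hilbertFunction_monotone (hirr Z) (Nat.zero_le (t * 1))
    simp only [RelSeries.singleton_length, Nat.choose_zero_right, RelSeries.last_singleton]
    omega
  | snoc p W hlt ih =>
    obtain ⟨E, hE, ih⟩ := ih
    rw [RelSeries.snoc_length, RelSeries.last_snoc]
    set Z := p.last
    have hZW : (Z : Set Y) ⊂ W := hlt
    obtain ⟨q, hqW, hqZ⟩ := Set.exists_of_ssubset hZW
    obtain ⟨C, hC, hCZ⟩ := isClosed_induced_iff.1 Z.isClosed
    obtain ⟨f, e, hf, hfC, hfq⟩ := exists_form_not_vanishesAt hC (q := q.1) fun h => hqZ <| by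
      rw [← hCZ]; exact h
    have hstep (t : ℕ) := hilbertFunction_add_le (Set.image_mono hZW.subset) hf
      (Z := Subtype.val '' (Z : Set Y)) (by
        rintro _ ⟨z, hz, rfl⟩
        rw [← hCZ] at hz
        exact hfC _ hz) t
      fun g hg h => (IsPreirreducible.vanishesAt_or (hirr W).2 hf hg h).resolve_left
        fun h' => hfq (h' _ ⟨q, hqW, rfl⟩)
    -- This constant is a multiple of `E` and at least `e`. One step in `t` therefore leaves room
    -- for a multiplication by `f`, and the inequality `hstep` becomes Pascal's rule.
    refine ⟨E * (e + 1), by positivity, fun t => ?_⟩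
    induction t with
    | zero => simp
    | succ t iht =>
      have hZ := hilbertFunction_monotone (hirr Z)
        (show t * E ≤ t * (E * (e + 1)) + e by nlinarith [Nat.zero_le (t * E * e)])
      have hW := hilbertFunction_monotone (hirr W)
        (show t * (E * (e + 1)) + e ≤ (t + 1) * (E * (e + 1)) by nlinarith)
      have := hstep (t * (E * (e + 1)))
      have := ih t
      rw [Nat.choose_succ_succ']
      omega

end Forms

/-! ### Closures of images of rational maps -/

section Parametrized

variable {K : Type*} [Field K] {ι σ : Type*}

attribute [local instance] zariskiTopology

/-- The image of the rational map given by a family of polynomials. -/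
def parametrizedSet (m : ι → MvPolynomial σ K) : Set (ℙ K (ι → K)) :=
  {q | ∃ (x : σ → K) (h : (fun i => MvPolynomial.eval x (m i)) ≠ 0), q = Projectivization.mk K _ h}

theorem eval_aeval (m : ι → MvPolynomial σ K) (f : MvPolynomial ι K) (x : σ → K) :
    MvPolynomial.eval x (MvPolynomial.aeval m f)
      = MvPolynomial.eval (fun i => MvPolynomial.eval x (m i)) f := by
  induction f using MvPolynomial.induction_on <;> simp_all

theorem forall_mem_closure_vanishesAt_iff {S : Set (ℙ K (ι → K))} {f : MvPolynomial ι K} {d : ℕ}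
    (hf : f.IsHomogeneous d) :
    (∀ q ∈ closure S, VanishesAt f q) ↔ ∀ q ∈ S, VanishesAt f q :=
  (isClosed_setOf_vanishesAt hf).closure_subset_iff

variable [Infinite K] {m : ι → MvPolynomial σ K}

/-- A form vanishes on a dense subset of the image of a rational map if and only if its pullback
is zero. -/
theorem forall_vanishesAt_iff_aeval_eq_zero (hm : ∃ i, m i ≠ 0) {S : Set (ℙ K (ι → K))}
    (hS : S ⊆ parametrizedSet m) {p : MvPolynomial σ K} (hp : p ≠ 0)
    (hpS : ∀ x, MvPolynomial.eval x p ≠ 0 → ∀ h : (fun i => MvPolynomial.eval x (m i)) ≠ 0,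
      Projectivization.mk K _ h ∈ S)
    {f : MvPolynomial ι K} {d : ℕ} (hf : f.IsHomogeneous d) :
    (∀ q ∈ S, VanishesAt f q) ↔ MvPolynomial.aeval m f = 0 := by
  obtain ⟨i, hi⟩ := hm
  constructor
  · intro h
    -- The factors `m i` and `p` absorb the points where the map is undefined or its value may miss
    -- `S`.
    have hzero : MvPolynomial.aeval m f * m i * p = 0 := by
      refine MvPolynomial.funext fun x => ?_
      by_cases hx : MvPolynomial.eval x p = 0
      · simp [hx]
      by_cases hv : (fun i => MvPolynomial.eval x (m i)) = 0
      · simp [show MvPolynomial.eval x (m i) = 0 from congrFun hv i]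
      · have := (vanishesAt_mk_iff hf _ hv).1 (h _ (hpS x hx hv))
        rw [map_mul, map_mul, eval_aeval, this]
        simp
    simpa [hi, hp] using hzero
  · intro h q hq
    obtain ⟨x, hx, rfl⟩ := hS hq
    rw [vanishesAt_mk_iff hf, ← eval_aeval, h, map_zero]

theorem forall_parametrizedSet_vanishesAt_iff (hm : ∃ i, m i ≠ 0) {f : MvPolynomial ι K} {d : ℕ}
    (hf : f.IsHomogeneous d) :
    (∀ q ∈ parametrizedSet m, VanishesAt f q) ↔ MvPolynomial.aeval m f = 0 :=
  forall_vanishesAt_iff_aeval_eq_zero hm subset_rfl one_ne_zero (fun x _ h => ⟨x, h, rfl⟩) hf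

/-- Vanishing of forms is detected by a homomorphism to a domain, so the vanishing ideal behaves as
a prime. -/
theorem isIrreducible_closure_parametrizedSet (hm : ∃ i, m i ≠ 0) :
    IsIrreducible (closure (parametrizedSet m)) := by
  refine IsIrreducible.closure ⟨?_, isPreirreducible_iff_isClosed_union_isClosed.2 ?_⟩
  · by_contra h
    rw [Set.not_nonempty_iff_eq_empty] at h
    have := (forall_parametrizedSet_vanishesAt_iff hm
      (MvPolynomial.isHomogeneous_one ι K)).1 (by simp [h])
    simp at this
  · intro Z₁ Z₂ h₁ h₂ hZ
    by_contra! hnot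
    obtain ⟨q₁, hq₁, hqZ₁⟩ := Set.not_subset.1 hnot.1
    obtain ⟨q₂, hq₂, hqZ₂⟩ := Set.not_subset.1 hnot.2
    obtain ⟨f₁, d₁, hf₁, hfZ₁, hfq₁⟩ := exists_form_not_vanishesAt h₁ hqZ₁
    obtain ⟨f₂, d₂, hf₂, hfZ₂, hfq₂⟩ := exists_form_not_vanishesAt h₂ hqZ₂
    have h := (forall_parametrizedSet_vanishesAt_iff hm (hf₁.mul hf₂)).1 fun q hq =>
      vanishesAt_mul.2 ((hZ hq).imp (hfZ₁ q) (hfZ₂ q))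
    rw [map_mul, mul_eq_zero, ← forall_parametrizedSet_vanishesAt_iff hm hf₁,
      ← forall_parametrizedSet_vanishesAt_iff hm hf₂] at h
    exact h.elim (fun h => hfq₁ (h _ hq₁)) fun h => hfq₂ (h _ hq₂)

end Parametrized

/-! ### Algebras generated by monomials -/

section Monomials

variable {K : Type*} [Field K] {ι σ : Type*}

theorem aeval_monomial_family (e : ι → σ →₀ ℕ) (u : ι →₀ ℕ) (c : K) :
    MvPolynomial.aeval (fun i => MvPolynomial.monomial (e i) (1 : K)) (MvPolynomial.monomial u c)
      = MvPolynomial.monomial (Finsupp.linearCombination ℕ e u) c := by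
  rw [MvPolynomial.aeval_monomial, MvPolynomial.algebraMap_eq, Finsupp.linearCombination_apply,
    Finsupp.prod, Finsupp.sum]
  simp_rw [MvPolynomial.monomial_pow, one_pow]
  rw [← MvPolynomial.monomial_sum_one, MvPolynomial.C_mul_monomial, mul_one]

theorem finrank_map_aeval_monomial_family [Finite ι] (e : ι → σ →₀ ℕ) (t : ℕ) :
    Module.finrank K ((MvPolynomial.homogeneousSubmodule ι K t).map
      (MvPolynomial.aeval fun i => MvPolynomial.monomial (e i) (1 : K)).toLinearMap)
      = (Finsupp.linearCombination ℕ e '' {u | u.degree = t}).ncard := by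
  have := Fintype.ofFinite ι
  have hfin := (finite_setOf_degree_eq (ι := ι) t).image (Finsupp.linearCombination ℕ e)
  have := hfin.fintype
  rw [MvPolynomial.homogeneousSubmodule_eq_finsupp_supported,
    AddMonoidAlgebra.supported_eq_span_single, Submodule.map_span, Set.image_image]
  have h := finrank_span_eq_card ((MvPolynomial.basisMonomials σ K).linearIndependent.comp
    (Subtype.val : Finsupp.linearCombination ℕ e '' {u | u.degree = t} → _)
    Subtype.val_injective)
  rw [← Nat.card_coe_set_eq, Nat.card_eq_fintype_card, ← h, Set.range_comp, Subtype.range_coe,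
    Set.image_image]
  refine congrArg (fun s : Set (MvPolynomial σ K) => Module.finrank K (Submodule.span K s))
    (Set.image_congr fun u _ => ?_)
  rw [MvPolynomial.single_eq_monomial]
  simpa using aeval_monomial_family e u (1 : K)

theorem homogeneousComponent_aeval {m : ι → MvPolynomial σ K} {d : ℕ}
    (hm : ∀ i, (m i).IsHomogeneous d) (hd : d ≠ 0) (t : ℕ) (g : MvPolynomial ι K) :
    MvPolynomial.homogeneousComponent (t * d) (MvPolynomial.aeval m g)
      = MvPolynomial.aeval m (MvPolynomial.homogeneousComponent t g) := by
  induction g using MvPolynomial.induction_on' with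
  | monomial u c =>
    have hu := MvPolynomial.isHomogeneous_monomial c (rfl : u.degree = u.degree)
    have hau := hu.aeval m hm
    rw [MvPolynomial.homogeneousComponent_of_mem hu, MvPolynomial.homogeneousComponent_of_mem hau,
      mul_comm d]
    simp only [Nat.mul_left_inj hd]
    split_ifs <;> simp
  | add p q hp hq => simp only [map_add, hp, hq]

theorem range_aeval_inf_homogeneousSubmodule {m : ι → MvPolynomial σ K} {d : ℕ}
    (hm : ∀ i, (m i).IsHomogeneous d) (hd : d = 0 → ∃ i, m i = 1) (t : ℕ) :
    Subalgebra.toSubmodule (Algebra.adjoin K (Set.range m))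
        ⊓ MvPolynomial.homogeneousSubmodule σ K (t * d)
      = (MvPolynomial.homogeneousSubmodule ι K t).map (MvPolynomial.aeval m).toLinearMap := by
  have hhom {g : MvPolynomial ι K} {s : ℕ} (hg : g.IsHomogeneous s) :
      (MvPolynomial.aeval m g).IsHomogeneous (s * d) := by
    rw [mul_comm]
    exact hg.aeval m hm
  rw [Algebra.adjoin_range_eq_range_aeval]
  apply le_antisymm
  · rintro _ ⟨⟨g, rfl⟩, hg⟩
    simp only [AlgHom.toRingHom_eq_coe, RingHom.coe_coe, SetLike.mem_coe,
      MvPolynomial.mem_homogeneousSubmodule] at hg ⊢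
    -- If `d = 0`, the target degree no longer sees `t`; a constant is then lifted to degree `t` by
    -- a power of a variable that maps to 1.
    rcases Nat.eq_zero_or_pos d with rfl | hpos
    · obtain ⟨i, hi⟩ := hd rfl
      rw [mul_zero] at hg
      refine ⟨MvPolynomial.C (MvPolynomial.coeff 0 (MvPolynomial.aeval m g))
        * MvPolynomial.X i ^ t, ?_, ?_⟩
      · simpa using (MvPolynomial.isHomogeneous_C ι _).mul (MvPolynomial.isHomogeneous_X_pow i t)
      · have := MvPolynomial.totalDegree_eq_zero_iff_eq_C.1
          (Nat.le_zero.1 hg.totalDegree_le)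
        conv_rhs => rw [this]
        simp [hi]
    · refine ⟨MvPolynomial.homogeneousComponent t g,
        MvPolynomial.homogeneousComponent_isHomogeneous t g, ?_⟩
      exact (homogeneousComponent_aeval hm hpos.ne' t g).symm.trans
        ((MvPolynomial.homogeneousComponent_of_mem hg).trans (if_pos rfl))
  · rintro _ ⟨g, hg, rfl⟩
    exact ⟨⟨g, rfl⟩, hhom hg⟩

end Monomials

/-! ### Sumsets as images of exponent vectors -/

section Sumsets

variable {n : ℕ} (A : Finset (Fin n → ℕ))

theorem coe_sumset (t : ℕ) :
    (sumset t A : Set (Fin n → ℕ))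
      = Finsupp.linearCombination ℕ (Subtype.val : A → Fin n → ℕ) '' {u | u.degree = t} := by
  ext b
  simp only [sumset, Finset.coe_image, Set.mem_image, Finset.mem_coe, Fintype.mem_piFinset,
    Set.mem_ofPred_eq]
  constructor
  · rintro ⟨a, ha, rfl⟩
    exact ⟨∑ i, Finsupp.single ⟨a i, ha i⟩ 1, by simp [map_sum], by simp [map_sum]⟩
  · rintro ⟨u, hu, rfl⟩
    induction t generalizing u with
    | zero =>
      obtain rfl : u = 0 := (Finsupp.degree_eq_zero_iff u).1 hu
      exact ⟨Fin.elim0, fun i => i.elim0, by simp⟩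
    | succ t ih =>
      obtain ⟨a, ha⟩ : ∃ a, u a ≠ 0 := by
        by_contra! h
        simp [show u = 0 from Finsupp.ext h] at hu
      have hle : Finsupp.single a 1 ≤ u := by
        simpa [Finsupp.single_le_iff, Nat.one_le_iff_ne_zero] using ha
      obtain ⟨v, rfl⟩ := exists_add_of_le hle
      obtain ⟨c, hc, hcv⟩ := ih v (by
        rw [map_add, Finsupp.degree_single] at hu
        omega)
      exact ⟨Fin.cons a.1 c, fun i => by cases i using Fin.cases <;> simp [hc],
        by simp [Fin.sum_univ_succ, hcv]⟩

theorem card_sumset (t : ℕ) :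
    (sumset t A).card =
      (Finsupp.linearCombination ℕ (Subtype.val : A → Fin n → ℕ) '' {u | u.degree = t}).ncard := by
  rw [← coe_sumset, Set.ncard_coe_finset]

theorem linearCombination_val_apply (u : A →₀ ℕ) (j : Fin n) :
    Finsupp.linearCombination ℕ (Subtype.val : A → Fin n → ℕ) u j = ∑ a, u a * a.1 j := by
  simp [Finsupp.linearCombination_apply, Finsupp.sum_fintype]

theorem sum_le_dA (a : A) : ∑ i, a.1 i ≤ dA A :=
  Finset.le_sup (f := fun a : Fin n → ℕ => ∑ i, a i) a.2

/-- The exponent vector of the monomial attached to `a`. -/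
noncomputable def omegaExponent (a : A) : Fin (n + 1) →₀ ℕ :=
  Finsupp.cons (dA A - ∑ i, a.1 i) (Finsupp.equivFunOnFinite.symm a.1)

theorem omegaMonomial_eq (K : Type*) [Field K] :
    omegaMonomial K A = fun a => MvPolynomial.monomial (omegaExponent A a) 1 := by
  funext a
  rw [MvPolynomial.monomial_eq, Finsupp.prod_fintype _ _ (by simp), Fin.prod_univ_succ]
  simp [omegaMonomial, omegaExponent]

theorem omegaMonomial_isHomogeneous (K : Type*) [Field K] (a : A) :
    (omegaMonomial K A a).IsHomogeneous (dA A) := by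
  rw [omegaMonomial_eq]
  refine MvPolynomial.isHomogeneous_monomial _ ?_
  rw [Finsupp.degree_eq_sum, Fin.sum_univ_succ]
  simp only [omegaExponent, Finsupp.cons_zero, Finsupp.cons_succ,
    Finsupp.equivFunOnFinite_symm_apply_apply]
  exact Nat.sub_add_cancel (sum_le_dA A a)

/-- Homogeneity forces the exponent of `x₀`, so the product monomial depends only on `t` and the sum
in `tA`. -/
theorem linearCombination_omegaExponent {t : ℕ} {u : A →₀ ℕ} (hu : u.degree = t) :
    Finsupp.linearCombination ℕ (omegaExponent A) u
      = Finsupp.cons (t * dA A - ∑ j, Finsupp.linearCombination ℕ Subtype.val u j)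
        (Finsupp.equivFunOnFinite.symm (Finsupp.linearCombination ℕ Subtype.val u)) := by
  ext j
  cases j using Fin.cases with
  | zero =>
    simp only [Finsupp.cons_zero, linearCombination_val_apply]
    rw [Finset.sum_comm, ← hu, Finsupp.degree_eq_sum, Finset.sum_mul]
    rw [Finsupp.linearCombination_apply, Finsupp.sum_fintype _ _ (by simp)]
    simp only [Finsupp.finsetSum_apply, Finsupp.smul_apply, smul_eq_mul, omegaExponent,
      Finsupp.cons_zero]
    refine eq_tsub_of_add_eq ?_
    rw [← Finset.sum_add_distrib]
    refine Finset.sum_congr rfl fun a _ => ?_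
    rw [← Finset.mul_sum, ← mul_add, Nat.sub_add_cancel (sum_le_dA A a)]
  | succ j =>
    simp [Finsupp.linearCombination_apply, Finsupp.sum_fintype, omegaExponent]

theorem ncard_image_linearCombination_omegaExponent (t : ℕ) :
    (Finsupp.linearCombination ℕ (omegaExponent A) '' {u | u.degree = t}).ncard
      = (sumset t A).card := by
  have himage := Set.image_congr (s := {u : A →₀ ℕ | u.degree = t})
    fun u hu => linearCombination_omegaExponent A hu
  rw [himage, card_sumset, ← Set.image_image (fun b : Fin n → ℕ => Finsupp.cons (t * dA A - ∑ j, b j)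
    (Finsupp.equivFunOnFinite.symm b)) (Finsupp.linearCombination ℕ Subtype.val)]
  refine Set.ncard_image_of_injective _ fun b c h => ?_
  have := congrArg Finsupp.tail h
  simpa using this

theorem sumset_nonempty {A : Finset (Fin n → ℕ)} (hA : A.Nonempty) (t : ℕ) :
    (sumset t A).Nonempty := by
  obtain ⟨a, ha⟩ := hA
  exact ⟨_, Finset.mem_image_of_mem _ (Fintype.mem_piFinset.2 fun _ => ha)⟩

/-! ### The Hilbert function of the monomial projection -/

theorem finrank_map_aeval_omegaMonomial (K : Type*) [Field K] (t : ℕ) :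
    Module.finrank K ((MvPolynomial.homogeneousSubmodule A K t).map
      (MvPolynomial.aeval (omegaMonomial K A)).toLinearMap) = (sumset t A).card := by
  rw [← ncard_image_linearCombination_omegaExponent, omegaMonomial_eq,
    finrank_map_aeval_monomial_family]

theorem rationalMapImage_subset (K : Type*) [Field K] :
    rationalMapImage K A ⊆ parametrizedSet (omegaMonomial K A) := by
  rintro _ ⟨x, _, h, rfl⟩
  exact ⟨x, h, rfl⟩

theorem hilbertFunction_monomialProjection (K : Type*) [Field K] [Infinite K]
    {A : Finset (Fin n → ℕ)} (hA : A.Nonempty) (t : ℕ) :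
    hilbertFunction (monomialProjection K A) t = (sumset t A).card := by
  rw [← finrank_map_aeval_omegaMonomial A K]
  refine hilbertFunction_eq_finrank_map _ _ _ fun f hf => ?_
  rw [monomialProjection, forall_mem_closure_vanishesAt_iff hf]
  -- Taking `p = x₀` excludes the origin, which is not a point of `ℙⁿ`.
  refine (forall_vanishesAt_iff_aeval_eq_zero ?_ (rationalMapImage_subset A K)
    (MvPolynomial.X_ne_zero 0) ?_ hf).symm
  · obtain ⟨a, ha⟩ := hA
    exact ⟨⟨a, ha⟩, by simp [omegaMonomial_eq]⟩
  · intro x hx h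
    refine ⟨x, ?_, h, rfl⟩
    rintro rfl
    simp at hx

theorem finrank_omegaAlgebraPiece (K : Type*) [Field K] {A : Finset (Fin n → ℕ)}
    (hA : A.Nonempty) (t : ℕ) :
    Module.finrank K (omegaAlgebraPiece K A (t * dA A)) = (sumset t A).card := by
  rw [← finrank_map_aeval_omegaMonomial A K, omegaAlgebraPiece, omegaAlgebra,
    range_aeval_inf_homogeneousSubmodule (omegaMonomial_isHomogeneous A K)]
  intro hd
  obtain ⟨a, ha⟩ := hA
  have hsum := sum_le_dA A ⟨a, ha⟩
  rw [hd, Nat.le_zero, Finset.sum_eq_zero_iff] at hsum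
  exact ⟨⟨a, ha⟩, by simp_all [omegaMonomial]⟩

end Sumsets

/-! ### Affine relations between the coordinates -/

section Relations

variable {n : ℕ} (A : Finset (Fin n → ℕ))

/-- The `j`-th coordinate as a function on `A`. -/
def coordinateRow (j : Fin n) : A → ℚ := fun a => a.1 j

/-- The span of the constant function and of the coordinates in `J`. -/
def rowSpan (J : Finset (Fin n)) : Submodule ℚ (A → ℚ) :=
  Submodule.span ℚ (insert 1 (coordinateRow A '' J))

/-- A functional separates row `j` from the span. Clear the denominators of its coefficients; `u`
and `v` are the positive and negative parts. -/
theorem exists_relation_of_notMem_rowSpan {J : Finset (Fin n)} {j : Fin n}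
    (hj : coordinateRow A j ∉ rowSpan A J) :
    ∃ u v : A →₀ ℕ, u.degree = v.degree ∧ (∀ i ∈ J, ∑ a, u a * a.1 i = ∑ a, v a * a.1 i) ∧
      ∑ a, u a * a.1 j ≠ ∑ a, v a * a.1 j := by
  obtain ⟨φ, hφj, hφ⟩ := Submodule.exists_dual_map_eq_bot_of_notMem hj inferInstance
  have hφ0 : ∀ x ∈ rowSpan A J, φ x = 0 := fun x hx =>
    (Submodule.mem_bot ℚ).1 (hφ ▸ Submodule.mem_map_of_mem hx)
  obtain ⟨N, hN⟩ := IsLocalization.exist_integer_multiples_of_finite (nonZeroDivisors ℤ)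
    (fun a : A => φ fun b => if a = b then 1 else 0)
  choose k hk using hN
  have hkφ (x : A → ℕ) : ((∑ a, k a * x a : ℤ) : ℚ) = N.1 * φ fun a => (x a : ℚ) := by
    rw [LinearMap.pi_apply_eq_sum_univ, Finset.mul_sum]
    push_cast
    refine Finset.sum_congr rfl fun a _ => ?_
    have : (k a : ℚ) = N.1 * φ fun b => if a = b then 1 else 0 := by simpa using hk a
    rw [this, smul_eq_mul]
    ring
  have hN0 : (N.1 : ℚ) ≠ 0 := by exact_mod_cast nonZeroDivisors.ne_zero N.2
  have hiff (x : A → ℕ) : ∑ a, (k a).toNat * x a = ∑ a, (-k a).toNat * x a ↔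
      φ (fun a => (x a : ℚ)) = 0 := by
    rw [← mul_eq_zero_iff_left hN0, ← hkφ, Int.cast_eq_zero]
    have hsub : ((∑ a, (k a).toNat * x a : ℕ) : ℤ) - ((∑ a, (-k a).toNat * x a : ℕ) : ℤ)
        = ∑ a, k a * x a := by
      push_cast
      rw [← Finset.sum_sub_distrib]
      refine Finset.sum_congr rfl fun a _ => ?_
      rw [← sub_mul, Int.toNat_sub_toNat_neg]
    rw [← hsub, sub_eq_zero, Nat.cast_inj]
  refine ⟨Finsupp.equivFunOnFinite.symm fun a => (k a).toNat,
    Finsupp.equivFunOnFinite.symm fun a => (-k a).toNat, ?_, fun i hi => ?_, ?_⟩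
  · have := (hiff 1).2 (hφ0 _ (Submodule.subset_span (by left; ext; simp)))
    simpa [Finsupp.degree_eq_sum] using this
  · exact (hiff fun a => a.1 i).2
      (hφ0 _ (Submodule.subset_span (Or.inr (Set.mem_image_of_mem _ hi))))
  · exact fun h => hφj ((hiff fun a => a.1 j).1 h)

/-- Pairing with `u` or `v` is linear on rows, so agreement on the spanning rows (the constant row
records the degree) extends to all of them. -/
theorem linearCombination_eq_of_forall_mem {J : Finset (Fin n)}
    (hJ : ∀ j, coordinateRow A j ∈ rowSpan A J) {u v : A →₀ ℕ} (huv : u.degree = v.degree)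
    (h : ∀ i ∈ J, Finsupp.linearCombination ℕ (Subtype.val : A → Fin n → ℕ) u i
      = Finsupp.linearCombination ℕ (Subtype.val : A → Fin n → ℕ) v i) :
    Finsupp.linearCombination ℕ (Subtype.val : A → Fin n → ℕ) u
      = Finsupp.linearCombination ℕ (Subtype.val : A → Fin n → ℕ) v := by
  let ψ (w : A →₀ ℕ) : (A → ℚ) →ₗ[ℚ] ℚ := Fintype.linearCombination ℚ fun a => (w a : ℚ)
  have hψ (w : A →₀ ℕ) (j : Fin n) : ψ w (coordinateRow A j)
      = (Finsupp.linearCombination ℕ (Subtype.val : A → Fin n → ℕ) w j : ℕ) := by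
    rw [linearCombination_val_apply]
    simp [ψ, Fintype.linearCombination_apply, coordinateRow, mul_comm]
  have heq : Set.EqOn (ψ u) (ψ v) (rowSpan A J) := by
    refine LinearMap.eqOn_span ?_
    rintro _ (rfl | ⟨i, hi, rfl⟩)
    · rw [Finsupp.degree_eq_sum, Finsupp.degree_eq_sum] at huv
      simp only [ψ, Fintype.linearCombination_apply, Pi.one_apply, one_smul]
      exact_mod_cast huv
    · rw [hψ, hψ, h i hi]
  funext j
  have := heq (hJ j)
  rw [hψ, hψ] at this
  exact_mod_cast this

/-- An element of `tA` is determined by its coordinates in `J`, each at most `t * dA A`. -/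
theorem card_sumset_le {J : Finset (Fin n)} (hJ : ∀ j, coordinateRow A j ∈ rowSpan A J) (t : ℕ) :
    (sumset t A).card ≤ (t * dA A + 1) ^ J.card := by
  have hcard : (Fintype.piFinset fun _ : J => Finset.range (t * dA A + 1)).card
      = (t * dA A + 1) ^ J.card := by simp
  have hmem {b : Fin n → ℕ} (hb : b ∈ sumset t A) : ∃ u : A →₀ ℕ, u.degree = t ∧
      Finsupp.linearCombination ℕ Subtype.val u = b := by
    rwa [← Finset.mem_coe, coe_sumset] at hb
  rw [← hcard]
  refine Finset.card_le_card_of_injOn (fun b i => b i) (fun b hb => ?_) fun b hb c hc hbc => ?_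
  · obtain ⟨u, rfl, rfl⟩ := hmem hb
    simp only [Finset.mem_coe, Fintype.mem_piFinset, Finset.mem_range, Nat.lt_succ_iff]
    intro i
    rw [linearCombination_val_apply, Finsupp.degree_eq_sum, Finset.sum_mul]
    gcongr with a
    exact (Finset.single_le_sum (fun _ _ => Nat.zero_le _) (Finset.mem_univ i.1)).trans
      (sum_le_dA A a)
  · obtain ⟨u, hu, rfl⟩ := hmem hb
    obtain ⟨v, hv, rfl⟩ := hmem hc
    exact linearCombination_eq_of_forall_mem A hJ (hu.trans hv.symm)
      fun i hi => congrFun hbc ⟨i, hi⟩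

end Relations

/-! ### Closures of subtori in the monomial projection -/

section Subtori

attribute [local instance] zariskiTopology

theorem isIrreducible_preimage_val {X : Type*} [TopologicalSpace X] {Y Z : Set X} (hZY : Z ⊆ Y)
    (hZ : IsIrreducible Z) : IsIrreducible (Subtype.val ⁻¹' Z : Set Y) := by
  obtain ⟨z, hz⟩ := hZ.nonempty
  refine ⟨⟨⟨z, hZY hz⟩, hz⟩, ?_⟩
  rintro _ _ ⟨u, hu, rfl⟩ ⟨v, hv, rfl⟩ ⟨x, hxZ, hxu⟩ ⟨y, hyZ, hyv⟩
  obtain ⟨w, hwZ, hw⟩ := hZ.2 u v hu hv ⟨x, hxZ, hxu⟩ ⟨y, hyZ, hyv⟩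
  exact ⟨⟨w, hZY hwZ⟩, hwZ, hw⟩

variable (K : Type*) [Field K] {n : ℕ} (A : Finset (Fin n → ℕ)) (J : Finset (Fin n))

/-- The exponent vector of the restriction to the coordinates in `J`. -/
noncomputable def restrictedExponent (a : A) : Fin n →₀ ℕ :=
  Finsupp.equivFunOnFinite.symm fun j => if j ∈ J then a.1 j else 0

/-- The restriction of the monomials attached to `A` to the subtorus where `x₀ = 1` and `x_j = 1`
for `j ∉ J`. -/
noncomputable def restrictedMonomial (a : A) : MvPolynomial (Fin n) K :=
  MvPolynomial.monomial (restrictedExponent A J a) 1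

theorem eval_restrictedMonomial (x : Fin n → K) (a : A) :
    MvPolynomial.eval x (restrictedMonomial K A J a)
      = ∏ j, (if j ∈ J then x j else 1) ^ a.1 j := by
  rw [restrictedMonomial, MvPolynomial.eval_monomial, one_mul, Finsupp.prod_fintype _ _ (by simp)]
  refine Finset.prod_congr rfl fun j _ => ?_
  by_cases hj : j ∈ J <;> simp [restrictedExponent, hj]

theorem parametrizedSet_restrictedMonomial_mono {J J' : Finset (Fin n)} (h : J ⊆ J') :
    parametrizedSet (restrictedMonomial K A J) ⊆ parametrizedSet (restrictedMonomial K A J') := by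
  rintro _ ⟨x, hx, rfl⟩
  have heq : (fun a => MvPolynomial.eval x (restrictedMonomial K A J a))
      = fun a => MvPolynomial.eval (fun j => if j ∈ J then x j else 1)
        (restrictedMonomial K A J' a) := by
    funext a
    simp only [eval_restrictedMonomial]
    refine Finset.prod_congr rfl fun j _ => ?_
    by_cases hj : j ∈ J
    · simp [hj, h hj]
    · simp [hj]
  exact ⟨_, heq ▸ hx, by congr 1⟩

theorem parametrizedSet_restrictedMonomial_subset :
    parametrizedSet (restrictedMonomial K A J) ⊆ rationalMapImage K A := by
  rintro _ ⟨x, hx, rfl⟩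
  have heq : (fun a => MvPolynomial.eval x (restrictedMonomial K A J a))
      = omegaValues K A (Fin.cons 1 fun j => if j ∈ J then x j else 1) := by
    funext a
    simp [eval_restrictedMonomial, omegaValues, omegaMonomial, map_prod]
  refine ⟨_, fun h => ?_, heq ▸ hx, by congr 1⟩
  simpa using congrFun h 0

variable {A} in
theorem exists_restrictedMonomial_ne_zero (hA : A.Nonempty) :
    ∃ a, restrictedMonomial K A J a ≠ 0 := by
  obtain ⟨a, ha⟩ := hA
  exact ⟨⟨a, ha⟩, by simp [restrictedMonomial]⟩

theorem linearCombination_restrictedExponent_apply (u : A →₀ ℕ) (j : Fin n) :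
    Finsupp.linearCombination ℕ (restrictedExponent A J) u j
      = if j ∈ J then ∑ a, u a * a.1 j else 0 := by
  rw [Finsupp.linearCombination_apply, Finsupp.sum_fintype _ _ (by simp)]
  by_cases hj : j ∈ J <;> simp [restrictedExponent, hj]

theorem aeval_restrictedMonomial (u : A →₀ ℕ) :
    MvPolynomial.aeval (restrictedMonomial K A J) (MvPolynomial.monomial u (1 : K))
      = MvPolynomial.monomial (Finsupp.linearCombination ℕ (restrictedExponent A J) u) 1 :=
  aeval_monomial_family _ _ _

/-- The form is the binomial `w^u - w^v` of a relation that holds for the coordinates in `J` but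
fails for `j`. -/
theorem exists_form_of_notMem_rowSpan {j : Fin n} (hj : coordinateRow A j ∉ rowSpan A J) :
    ∃ (f : MvPolynomial A K) (d : ℕ), f.IsHomogeneous d ∧
      MvPolynomial.aeval (restrictedMonomial K A J) f = 0 ∧
      MvPolynomial.aeval (restrictedMonomial K A (insert j J)) f ≠ 0 := by
  obtain ⟨u, v, hdeg, hJ, hne⟩ := exists_relation_of_notMem_rowSpan A hj
  refine ⟨MvPolynomial.monomial u 1 - MvPolynomial.monomial v 1, u.degree,
    (MvPolynomial.isHomogeneous_monomial _ rfl).sub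
      (MvPolynomial.isHomogeneous_monomial _ hdeg.symm), ?_, ?_⟩
  · rw [map_sub, aeval_restrictedMonomial, aeval_restrictedMonomial, sub_eq_zero]
    refine congrArg (fun w => MvPolynomial.monomial w (1 : K)) (Finsupp.ext fun i => ?_)
    rw [linearCombination_restrictedExponent_apply, linearCombination_restrictedExponent_apply]
    split_ifs with hi
    · exact hJ i hi
    · rfl
  · rw [map_sub, aeval_restrictedMonomial, aeval_restrictedMonomial, sub_ne_zero]
    intro h
    have := DFunLike.congr_fun (MvPolynomial.monomial_left_injective one_ne_zero h) j
    rw [linearCombination_restrictedExponent_apply, linearCombination_restrictedExponent_apply,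
      if_pos (Finset.mem_insert_self _ _), if_pos (Finset.mem_insert_self _ _)] at this
    exact hne this

variable {A}

/-- The closure of the image of the subtorus given by `J`, as a subset of the monomial
projection. -/
noncomputable def subtorusClosure [Infinite K] (hA : A.Nonempty) :
    TopologicalSpace.IrreducibleCloseds (monomialProjection K A) where
  carrier := Subtype.val ⁻¹' closure (parametrizedSet (restrictedMonomial K A J))
  isIrreducible' := isIrreducible_preimage_val
    (closure_mono (parametrizedSet_restrictedMonomial_subset K A J))
    (isIrreducible_closure_parametrizedSet (exists_restrictedMonomial_ne_zero K J hA))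
  isClosed' := isClosed_closure.preimage continuous_subtype_val

variable {J} in
theorem subtorusClosure_lt [Infinite K] (hA : A.Nonempty) {j : Fin n}
    (hj : coordinateRow A j ∉ rowSpan A J) :
    subtorusClosure K J hA < subtorusClosure K (insert j J) hA := by
  refine lt_of_le_not_ge (fun q hq => closure_mono
    (parametrizedSet_restrictedMonomial_mono K A (Finset.subset_insert j J)) hq) fun hle => ?_
  obtain ⟨f, d, hf, hzero, hne⟩ := exists_form_of_notMem_rowSpan K A J hj
  refine hne ((forall_parametrizedSet_vanishesAt_iff
    (exists_restrictedMonomial_ne_zero K _ hA) hf).1 fun q hq => ?_)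
  have hqY : q ∈ monomialProjection K A :=
    subset_closure (parametrizedSet_restrictedMonomial_subset K A _ hq)
  have hqJ : q ∈ closure (parametrizedSet (restrictedMonomial K A J)) :=
    @hle ⟨q, hqY⟩ (subset_closure hq)
  refine (forall_mem_closure_vanishesAt_iff hf).2 ?_ q hqJ
  exact (forall_parametrizedSet_vanishesAt_iff (exists_restrictedMonomial_ne_zero K _ hA) hf).2
    hzero

/-- Take `J` maximal among the sets reached by a chain of length `|J|` ending at its subtorus
closure. A row outside the span would extend the chain. -/
theorem exists_ltSeries_of_rowSpan [Infinite K] (hA : A.Nonempty) :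
    ∃ J : Finset (Fin n), (∀ j, coordinateRow A j ∈ rowSpan A J) ∧
      ∃ s : LTSeries (TopologicalSpace.IrreducibleCloseds (monomialProjection K A)),
        s.length = J.card := by
  let S : Set (Finset (Fin n)) :=
    {J | ∃ s : LTSeries (TopologicalSpace.IrreducibleCloseds (monomialProjection K A)),
      s.length = J.card ∧ s.last = subtorusClosure K J hA}
  have hS : S.Nonempty := ⟨∅, RelSeries.singleton _ (subtorusClosure K ∅ hA), by simp, by simp⟩
  obtain ⟨J, ⟨s, hs, hlast⟩, hmax⟩ := S.toFinite.exists_maximal hS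
  refine ⟨J, fun j => ?_, s, hs⟩
  by_contra hj
  have hjJ : j ∉ J := fun h => hj (Submodule.subset_span (Or.inr (Set.mem_image_of_mem _ h)))
  have hlt : s.last < subtorusClosure K (insert j J) hA := hlast ▸ subtorusClosure_lt K hA hj
  have hmem : insert j J ∈ S :=
    ⟨s.snoc _ hlt, by simp [hs, Finset.card_insert_of_notMem hjJ], by simp⟩
  exact hjJ (hmax hmem (Finset.subset_insert j J) (Finset.mem_insert_self j J))

theorem choose_le_hilbertFunction_monomialProjection
    (s : LTSeries (TopologicalSpace.IrreducibleCloseds (monomialProjection K A))) :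
    ∃ E, 0 < E ∧ ∀ t : ℕ,
      t.choose s.length ≤ hilbertFunction (monomialProjection K A) (t * E) := by
  obtain ⟨E, hE, h⟩ := exists_choose_le_hilbertFunction s
  exact ⟨E, hE, fun t => (h t).trans (hilbertFunction_mono (Subtype.coe_image_subset _ _) _)⟩

theorem exists_hilbertPolynomial [Infinite K] (hA : A.Nonempty) :
    ∃ (P : Polynomial ℚ) (r : ℕ), AgreesEventually (fun t => (sumset t A).card) P ∧
      P.degree = (r : WithBot ℕ) ∧ projDim (monomialProjection K A) = (r : WithBot ℕ∞) ∧
      r ≤ n := by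
  have : Nonempty A := hA.to_subtype
  obtain ⟨P, hP⟩ := exists_agreesEventually_ncard_image
    (Finsupp.linearCombination ℕ (Subtype.val : A → Fin n → ℕ)).toAddMonoidHom
  have hcard : AgreesEventually (fun t => (sumset t A).card) P := by
    simp_rw [card_sumset]
    exact hP
  obtain ⟨J, hJ, s, hs⟩ := exists_ltSeries_of_rowSpan K hA
  have hle : P.natDegree ≤ J.card := hcard.natDegree_le (card_sumset_le A hJ)
  have hlength (s : LTSeries (TopologicalSpace.IrreducibleCloseds (monomialProjection K A))) :
      s.length ≤ P.natDegree := by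
    obtain ⟨E, hE, h⟩ := choose_le_hilbertFunction_monomialProjection K s
    simp_rw [hilbertFunction_monomialProjection K hA] at h
    exact hcard.le_natDegree hE h
  have hP0 : P ≠ 0 := by
    rintro rfl
    obtain ⟨t, ht⟩ := Filter.Eventually.exists hcard
    rw [Polynomial.eval_zero, Nat.cast_eq_zero] at ht
    exact (sumset_nonempty hA t).card_pos.ne' ht
  refine ⟨P, J.card, hcard, ?_, le_antisymm ?_ ?_, by simpa using J.card_le_univ⟩
  · rw [Polynomial.degree_eq_natDegree hP0, le_antisymm hle (hs ▸ hlength s)]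
  · exact iSup_le fun s => by exact_mod_cast (hlength s).trans hle
  · rw [← hs]
    exact Order.LTSeries.length_le_krullDim s

end Subtori

end SumsetVeronese

theorem proposition3p3 (K : Type*) [Field K] [IsAlgClosed K] [CharZero K]
    (n : ℕ) (hn : 1 ≤ n) (A : Finset (Fin n → ℕ)) (hA : A.Nonempty) :
    (∀ t : ℕ,
      SumsetVeronese.hilbertFunction (SumsetVeronese.monomialProjection K A) t
          = (SumsetVeronese.sumset t A).card ∧
      Module.finrank K (SumsetVeronese.omegaAlgebraPiece K A (t * SumsetVeronese.dA A))
          = (SumsetVeronese.sumset t A).card) ∧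
    ∃ (P : Polynomial ℚ) (r : ℕ),
      (∀ Q : Polynomial ℚ,
        SumsetVeronese.AgreesEventually
          (SumsetVeronese.hilbertFunction (SumsetVeronese.monomialProjection K A)) Q ↔ Q = P) ∧
      SumsetVeronese.AgreesEventually (fun t => (SumsetVeronese.sumset t A).card) P ∧
      P.degree = (r : WithBot ℕ) ∧
      SumsetVeronese.projDim (SumsetVeronese.monomialProjection K A) = (r : WithBot ℕ∞) ∧
      r ≤ n := by
  have hHF : SumsetVeronese.hilbertFunction (SumsetVeronese.monomialProjection K A)
      = fun t => (SumsetVeronese.sumset t A).card :=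
    funext (SumsetVeronese.hilbertFunction_monomialProjection K hA)
  refine ⟨fun t => ⟨congrFun hHF t, SumsetVeronese.finrank_omegaAlgebraPiece K hA t⟩, ?_⟩
  obtain ⟨P, r, hP, hdeg, hdim, hr⟩ := SumsetVeronese.exists_hilbertPolynomial K hA
  refine ⟨P, r, fun Q => ?_, hP, hdeg, hdim, hr⟩
  rw [hHF]
  exact ⟨fun hQ => hQ.unique hP, fun hQ => hQ ▸ hP⟩
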